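/- Conventions. All spaces are base-pointed and all maps are base-point preserving and continuous. A path-connected covering space $(C,p_C)$ of $X$ is a path-connected pointed space $C$ with a covering map $p_C\colon C\to X$; an isomorphism of covering spaces is a homeomorphism over $X$. We say that $C_1$ covers $C_2$, written $C_1\succ C_2$, if there is a map $f\colon C_1\to C_2$ with $p_{C_1}=p_{C_2}\circ f$; this is a partial order on the isomorphism classes of path-connected covering spaces of $X$, and a join is a least upper bound for it (a class that covers all members of the family and is covered by every other such class). A class is trivial if its covering map is a homeomorphism, and minimal if it is nontrivial and covers no class other than itself and the trivial one. If a class is a join of finitely many minimal classes, its join number is the smallest number of minimal classes whose join it is; the trivial class is the join of the empty family and has join number $0$. For a class $X'$, let $\pi_{X'}\le\pi_1(X)$ be the image of $\pi_1(X')$ under the covering map. The Frattini subgroup $\Phi(G)$ of a finite group $G$ is the intersection of its maximal subgroups ($\Phi(G)=G$ if $G$ is trivial), and the rank of $G$ is the smallest integer $n\ge 0$ such that $G$ can be generated by $n$ elements. The Frattini cover is the class $X'$ with $\pi_{X'}=\Phi(\pi_1(X))$. For $0\le k\le n$ put $$\binom{n}{k}_p=\prod_{i=0}^{k-1}\frac{p^n-p^i}{p^k-p^i},\qquad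 S_{n,p}=\sum_{k=0}^n\binom{n}{k}_p .$$ Theorem. Let $p$ be a prime and let $X$ be a compact connected smooth manifold whose fundamental group $\pi_1(X)$ is a finite $p$-group of rank $n$. Then the Frattini cover exists and is unique, and for every integer $k$ with $0\le k\le n$: 1. The number of isomorphism classes of path-connected covering spaces of $X$ that are covered by the Frattini cover is $S_{n,p}$. 2. The number of isomorphism classes of path-connected covering spaces of $X$ that are covered by the Frattini cover and have join number $n-k$ is $\binom{n}{k}_p$. 3. The number of isomorphism classes of path-connected covering spaces $X'$ of $X$ that are covered by the Frattini cover and such that $\pi_{X'}/\Phi(\pi_1(X))$ has rank $k$ is $\binom{n}{k}_p$. -/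

import Mathlib

open scoped Manifold ContDiff

universe u

noncomputable section

/-- The Gaussian binomial coefficient
`(q^n - 1)(q^n - q) ⋯ (q^n - q^(k-1)) / ((q^k - 1)(q^k - q) ⋯ (q^k - q^(k-1)))`
(equal to `1` for `k = 0`). -/
def gaussianBinomial (n k : ℕ) (q : ℚ) : ℚ :=
  (∏ i ∈ Finset.range k, (q ^ n - q ^ i)) / (∏ i ∈ Finset.range k, (q ^ k - q ^ i))

/-- The sum `S_{n,q}` of the Gaussian binomial coefficients `[n choose k]_q`, `0 ≤ k ≤ n`. -/
def gaussianSum (n : ℕ) (q : ℚ) : ℚ :=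
  ∑ k ∈ Finset.range (n + 1), gaussianBinomial n k q

/-- A base-pointed path-connected covering space of the base-pointed space `(X, x₀)`. -/
structure PathConnectedCover (X : Type u) [TopologicalSpace X] (x₀ : X) where
  /-- the total space -/
  space : Type u
  [topology : TopologicalSpace space]
  [pathConnected : PathConnectedSpace space]
  /-- the base point of the total space -/
  base : space
  /-- the covering map -/
  proj : C(space, X)
  isCoveringMap : IsCoveringMap proj
  proj_base : proj base = x₀

namespace PathConnectedCover

attribute [instance] topology pathConnected

variable {X : Type u} [TopologicalSpace X] {x₀ : X}

/-- `C₁` covers `C₂`: there is a base-point preserving continuous map `f : C₁ → C₂`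
with `p₁ = p₂ ∘ f`. -/
def Covers (C₁ C₂ : PathConnectedCover X x₀) : Prop :=
  ∃ f : C(C₁.space, C₂.space), f C₁.base = C₂.base ∧ C₁.proj = C₂.proj.comp f

/-- An isomorphism of covers: a base-point preserving homeomorphism over `X`. -/
def Isomorphic (C₁ C₂ : PathConnectedCover X x₀) : Prop :=
  ∃ f : C₁.space ≃ₜ C₂.space, f C₁.base = C₂.base ∧ ∀ y, C₁.proj y = C₂.proj (f y)

theorem Isomorphic.symm {C₁ C₂ : PathConnectedCover X x₀} (h : C₁.Isomorphic C₂) :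
    C₂.Isomorphic C₁ := by
  obtain ⟨f, hf, hp⟩ := h
  exact ⟨f.symm, by simp [← hf], fun y => by simp [hp]⟩

theorem Isomorphic.trans {C₁ C₂ C₃ : PathConnectedCover X x₀} (h : C₁.Isomorphic C₂)
    (h' : C₂.Isomorphic C₃) : C₁.Isomorphic C₃ := by
  obtain ⟨f, hf, hp⟩ := h
  obtain ⟨g, hg, hq⟩ := h'
  exact ⟨f.trans g, by simp [hf, hg], fun y => by simp [hp, hq]⟩

theorem Isomorphic.covers {C₁ C₂ : PathConnectedCover X x₀} (h : C₁.Isomorphic C₂) :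
    C₁.Covers C₂ := by
  obtain ⟨f, hf, hp⟩ := h
  exact ⟨⟨f, f.continuous⟩, hf, ContinuousMap.ext hp⟩

theorem Covers.refl (C : PathConnectedCover X x₀) : C.Covers C :=
  ⟨ContinuousMap.id _, rfl, rfl⟩

theorem Covers.trans {C₁ C₂ C₃ : PathConnectedCover X x₀} (h : C₁.Covers C₂)
    (h' : C₂.Covers C₃) : C₁.Covers C₃ := by
  obtain ⟨f, hf, hp⟩ := h
  obtain ⟨g, hg, hq⟩ := h'
  exact ⟨g.comp f, by simp [hf, hg], by rw [hp, hq, ContinuousMap.comp_assoc]⟩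

theorem Covers.antisymm {C₁ C₂ : PathConnectedCover X x₀} (h : C₁.Covers C₂)
    (h' : C₂.Covers C₁) : C₁.Isomorphic C₂ := by
  obtain ⟨f, hf, hp⟩ := h
  obtain ⟨g, hg, hq⟩ := h'
  have hp' : ∀ y, C₁.proj y = C₂.proj (f y) := fun y => by rw [hp]; rfl
  have hq' : ∀ y, C₂.proj y = C₁.proj (g y) := fun y => by rw [hq]; rfl
  have e₁ : g ∘ f = id := C₁.isCoveringMap.eq_of_comp_eq (by fun_prop) continuous_id
    (funext fun y => (hq' (f y)).symm.trans (hp' y).symm) C₁.base (by simp [hf, hg])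
  have e₂ : f ∘ g = id := C₂.isCoveringMap.eq_of_comp_eq (by fun_prop) continuous_id
    (funext fun y => (hp' (g y)).symm.trans (hq' y).symm) C₂.base (by simp [hf, hg])
  exact ⟨⟨⟨f, g, congrFun e₁, congrFun e₂⟩, f.continuous, g.continuous⟩, hf, hp'⟩

/-- The subgroup `π_C` of `π₁(X, x₀)` corresponding to a path-connected cover `C`: the image
of `π₁(C)` under the covering map. -/
def subgroup (C : PathConnectedCover X x₀) : Subgroup (FundamentalGroup X x₀) :=
  (FundamentalGroup.mapOfEq C.proj C.proj_base).range

theorem Covers.subgroup_le {C₁ C₂ : PathConnectedCover X x₀} (h : C₁.Covers C₂) :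
    C₁.subgroup ≤ C₂.subgroup := by
  obtain ⟨f, hf, hp⟩ := h
  rintro _ ⟨p, rfl⟩
  refine ⟨FundamentalGroup.mapOfEq f hf p, ?_⟩
  simp only [FundamentalGroup.mapOfEq_apply]
  induction p using Quotient.inductionOn with
  | h γ =>
    refine congrArg Path.Homotopic.Quotient.mk (Path.ext (funext fun t => ?_))
    exact (DFunLike.congr_fun hp (γ t)).symm

instance setoid (X : Type u) [TopologicalSpace X] (x₀ : X) :
    Setoid (PathConnectedCover X x₀) where
  r := Isomorphic
  iseqv := ⟨fun _ => ⟨Homeomorph.refl _, rfl, fun _ => rfl⟩, Isomorphic.symm, Isomorphic.trans⟩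

end PathConnectedCover

/-- The isomorphism classes of base-pointed path-connected covering spaces of `(X, x₀)`. -/
def CoverClass (X : Type u) [TopologicalSpace X] (x₀ : X) : Type (u + 1) :=
  Quotient (PathConnectedCover.setoid X x₀)

namespace CoverClass

variable {X : Type u} [TopologicalSpace X] {x₀ : X}

/-- The partial order on isomorphism classes: `c ≤ d` when `d` covers `c`. -/
instance : PartialOrder (CoverClass X x₀) where
  le := Quotient.lift₂ (fun C D => D.Covers C) fun _ _ _ _ h h' => propext
    ⟨fun k => (h'.symm.covers.trans k).trans h.covers,
      fun k => (h'.covers.trans k).trans h.symm.covers⟩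
  le_refl c := Quotient.inductionOn c PathConnectedCover.Covers.refl
  le_trans a b c := Quotient.inductionOn₃ a b c fun _ _ _ h h' => h'.trans h
  le_antisymm a b := Quotient.inductionOn₂ a b fun _ _ h h' => Quotient.sound (h'.antisymm h)

/-- The subgroup of `π₁(X, x₀)` corresponding to an isomorphism class of covers. -/
def subgroup : CoverClass X x₀ → Subgroup (FundamentalGroup X x₀) :=
  Quotient.lift PathConnectedCover.subgroup fun _ _ h =>
    le_antisymm h.covers.subgroup_le h.symm.covers.subgroup_le

/-- The trivial class: the covering map is a homeomorphism. -/
def IsTrivial (c : CoverClass X x₀) : Prop :=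
  ∃ C : PathConnectedCover X x₀, Quotient.mk _ C = c ∧ IsHomeomorph C.proj

/-- A minimal cover: a nontrivial class such that every class strictly below it (that is, covered
by it and different from it) is trivial. -/
def IsMinimal (c : CoverClass X x₀) : Prop :=
  ¬ c.IsTrivial ∧ ∀ d < c, d.IsTrivial

/-- `c` is a join of `m` (distinct) minimal covers; the join is the least upper bound for the
order above, and the join of the empty family is the trivial cover. -/
def IsJoinOfMinimal (c : CoverClass X x₀) (m : ℕ) : Prop :=
  ∃ S : Finset (CoverClass X x₀), S.card = m ∧ (∀ s ∈ S, s.IsMinimal) ∧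
    IsLUB (S : Set (CoverClass X x₀)) c

/-- `c` is a join of minimal covers and has join number `m`: the smallest number of minimal
covers whose join is `c` is `m`. -/
def HasJoinNumber (c : CoverClass X x₀) (m : ℕ) : Prop :=
  IsLeast {j : ℕ | c.IsJoinOfMinimal j} m

/-- The Frattini cover: the class corresponding to the Frattini subgroup of `π₁(X, x₀)`. -/
def IsFrattini (c : CoverClass X x₀) : Prop :=
  c.subgroup = frattini (FundamentalGroup X x₀)

end CoverClass

end

/-!
The proof translates covers into subgroups and these into subspaces of a finite vector space, where
they are counted.

Topology. A manifold is locally path-connected and its points have simply connected neighbourhoods,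
so isomorphism classes of pointed path-connected covers form the lattice of subgroups of the
fundamental group `G` with the order reversed (`CoverClass.subgroupOrderIso`). Injectivity and
compatibility with the order are the lifting criterion (`PathConnectedCover.covers_iff`). For
surjectivity, an action of `G` on a discrete set `F` gives a bundle with fibre `F` whose transition
functions are locally constant: each simply connected neighbourhood carries a framing, a choice of
homotopy classes of paths from `x₀` to its points, and two framings differ by locally constant
elements of `G` (`associatedCore`). Lifting paths explicitly shows that the total space is
path-connected if the action is transitive, and that the subgroup of the resulting cover is the
stabilizer of a point (`subgroup_associatedCover`); the action on cosets of `H` yields the cover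
with subgroup `H`. Under this correspondence minimal covers are maximal subgroups and joins are
intersections (`CoverClass.isJoinOfMinimal_iff`).

Algebra. Maximal subgroups of a finite `p`-group are normal of index `p`, so the quotient `V` of `G`
by the Frattini subgroup `Φ` is a vector space over `ZMod p`
(`IsPGroup.exists_ker_eq_frattini`), and its dimension is the rank of `G` because elements of `Φ`
are redundant in generating sets (`rank_eq_of_ker_eq_frattini`). Covers below the Frattini cover
thus correspond to subgroups `H ≥ Φ`, that is, to subspaces `W` of `V`. The rank of `H ⧸ Φ` is the
dimension of `W` (`rank_quotient_eq_finrank`), and the join number is the least number of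
hyperplanes with intersection `W`, which is the codimension (`isLeast_card_isCoatom`). Finally, the
number of `k`-dimensional subspaces is a Gaussian binomial coefficient (`card_submodule_finrank_eq`).
-/

noncomputable section

open CategoryTheory Topology unitInterval

/-! ### Homotopy classes of paths and simply connected neighbourhoods -/

/-- The homotopy class of a path, as a morphism of the fundamental groupoid. -/
def Path.toHom {X : Type u} [TopologicalSpace X] {x y : X} (γ : Path x y) :
    FundamentalGroupoid.mk x ⟶ FundamentalGroupoid.mk y :=
  Path.Homotopic.Quotient.mk γ

namespace Path

variable {X : Type u} [TopologicalSpace X] {x y z : X}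

theorem toHom_refl (x : X) : (Path.refl x).toHom = 𝟙 (FundamentalGroupoid.mk x) := rfl

theorem toHom_trans (γ : Path x y) (δ : Path y z) : (γ.trans δ).toHom = γ.toHom ≫ δ.toHom :=
  rfl

theorem toHom_surjective (f : FundamentalGroupoid.mk x ⟶ FundamentalGroupoid.mk y) :
    ∃ γ : Path x y, γ.toHom = f :=
  Path.Homotopic.Quotient.mk_surjective f

theorem toHom_eq_iff {γ δ : Path x y} : γ.toHom = δ.toHom ↔ γ.Homotopic δ :=
  Path.Homotopic.Quotient.eq

end Path

/-- A space in which every point has a simply connected open neighbourhood. -/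
class HasSimplyConnectedNhds (X : Type u) [TopologicalSpace X] : Prop where
  exists_isOpen : ∀ x : X, ∃ U : Set X, IsOpen U ∧ x ∈ U ∧ IsSimplyConnected U

theorem HasSimplyConnectedNhds.of_chartedSpace {E : Type*} [NormedAddCommGroup E]
    [NormedSpace ℝ E] (X : Type u) [TopologicalSpace X] [ChartedSpace E X] :
    HasSimplyConnectedNhds X where
  exists_isOpen x := by
    let φ := chartAt E x
    obtain ⟨r, hr, hball⟩ := Metric.isOpen_iff.1 φ.open_target _ (mem_chart_target E x)
    refine ⟨φ.symm '' Metric.ball (φ x) r,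
      φ.symm.isOpen_image_of_subset_source Metric.isOpen_ball hball,
      ⟨φ x, Metric.mem_ball_self hr, φ.left_inv (mem_chart_source E x)⟩, ?_⟩
    have hc : ContractibleSpace (Metric.ball (φ x) r) :=
      (convex_ball (φ x) r).contractibleSpace ⟨_, Metric.mem_ball_self hr⟩
    exact (φ.symm.homeomorphOfImageSubsetSource hball rfl).symm.toHomotopyEquiv.simplyConnectedSpace

theorem IsSimplyConnected.homotopic {X : Type u} [TopologicalSpace X] {U : Set X}
    (hU : IsSimplyConnected U) {y z : X} (γ δ : Path y z) (hγ : ∀ t, γ t ∈ U)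
    (hδ : ∀ t, δ t ∈ U) : γ.Homotopic δ := by
  have := hU.simplyConnectedSpace
  have hy : y ∈ U := by simpa using hγ 0
  have hz : z ∈ U := by simpa using hγ 1
  let γ' : Path (⟨y, hy⟩ : U) ⟨z, hz⟩ :=
    { toFun := fun t => ⟨γ t, hγ t⟩, source' := by simp, target' := by simp }
  let δ' : Path (⟨y, hy⟩ : U) ⟨z, hz⟩ :=
    { toFun := fun t => ⟨δ t, hδ t⟩, source' := by simp, target' := by simp }
  exact (SimplyConnectedSpace.paths_homotopic γ' δ').map ⟨Subtype.val, continuous_subtype_val⟩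

/-! ### The covering space of an action of the fundamental group -/

section Framing

variable (X : Type u) [TopologicalSpace X] (x₀ : X)

/-- Every point has an open neighbourhood `U` whose points `y` can be joined to `x₀` by homotopy
classes `τ y` of paths that are compatible with all paths inside `U`. -/
theorem exists_framing [PathConnectedSpace X] [HasSimplyConnectedNhds X] (x : X) :
    ∃ (U : Set X) (τ : ∀ y : X, FundamentalGroupoid.mk x₀ ⟶ FundamentalGroupoid.mk y),
      IsOpen U ∧ x ∈ U ∧
        ∀ (y z : X) (w : Path y z), (∀ t, w t ∈ U) → τ y ≫ w.toHom = τ z := by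
  classical
  obtain ⟨U, hUo, hxU, hU⟩ := HasSimplyConnectedNhds.exists_isOpen x
  refine ⟨U, fun y => if h : y ∈ U then (PathConnectedSpace.somePath x₀ x).toHom ≫
    (hU.isPathConnected.joinedIn x hxU y h).somePath.toHom
    else (PathConnectedSpace.somePath x₀ y).toHom, hUo, hxU, fun y z w hw => ?_⟩
  have hy : y ∈ U := by simpa using hw 0
  have hz : z ∈ U := by simpa using hw 1
  simp only [hy, hz, dif_pos, Category.assoc]
  congr 1
  rw [← Path.toHom_trans, Path.toHom_eq_iff]
  refine hU.homotopic _ _ (fun t => ?_) (JoinedIn.somePath_mem _)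
  have : ((hU.isPathConnected.joinedIn x hxU y hy).somePath.trans w) t ∈
      Set.range ((hU.isPathConnected.joinedIn x hxU y hy).somePath.trans w) := ⟨t, rfl⟩
  rw [Path.trans_range] at this
  rcases this with ⟨s, hs⟩ | ⟨s, hs⟩
  · exact hs ▸ JoinedIn.somePath_mem _ s
  · exact hs ▸ hw s

variable [PathConnectedSpace X] [HasSimplyConnectedNhds X]

/-- The open neighbourhood of `i` chosen from `exists_framing`. -/
def framedNhd (i : X) : Set X := (exists_framing X x₀ i).choose

/-- The homotopy classes of paths from `x₀` to the points `y` that `exists_framing` provides for the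
neighbourhood of `i`; they are meaningful for `y ∈ framedNhd X x₀ i` only. -/
def framing (i y : X) : FundamentalGroupoid.mk x₀ ⟶ FundamentalGroupoid.mk y :=
  (exists_framing X x₀ i).choose_spec.choose y

theorem isOpen_framedNhd (i : X) : IsOpen (framedNhd X x₀ i) :=
  (exists_framing X x₀ i).choose_spec.choose_spec.1

theorem mem_framedNhd (i : X) : i ∈ framedNhd X x₀ i :=
  (exists_framing X x₀ i).choose_spec.choose_spec.2.1

theorem framing_comp (i : X) {y z : X} (w : Path y z) (hw : ∀ t, w t ∈ framedNhd X x₀ i) :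
    framing X x₀ i y ≫ w.toHom = framing X x₀ i z :=
  (exists_framing X x₀ i).choose_spec.choose_spec.2.2 y z w hw

variable {X} in
/-- The loop at `x₀` which runs to `y` in the framing `i` and back in the framing `j`. -/
def framingChange (i j y : X) : FundamentalGroup X x₀ :=
  framing X x₀ i y ≫ inv (framing X x₀ j y)

/-- The cocycle condition. The product of loops in `FundamentalGroup` is concatenation in the
opposite order, hence the order of the factors. -/
theorem framingChange_mul (i j k y : X) :
    framingChange x₀ j k y * framingChange x₀ i j y = framingChange x₀ i k y := by
  change framingChange x₀ i j y ≫ framingChange x₀ j k y = _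
  simp [framingChange]

theorem framingChange_self (i y : X) : framingChange x₀ i i y = 1 := by
  simp only [framingChange, IsIso.hom_inv_id]
  rfl

theorem framingChange_eq_of_path {i j y z : X} (w : Path y z)
    (hw : ∀ t, w t ∈ framedNhd X x₀ i ∩ framedNhd X x₀ j) :
    framingChange x₀ i j y = framingChange x₀ i j z := by
  simp only [framingChange]
  have hi := framing_comp X x₀ i w fun t => (hw t).1
  have hj := framing_comp X x₀ j w fun t => (hw t).2
  simp only [← hi, ← hj, IsIso.inv_comp, Category.assoc, IsIso.hom_inv_id_assoc]

/-- Framing changes are locally constant, so that they can serve as transition functions of a bundle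
with discrete fibre. -/
theorem framingChange_eventuallyEq [LocallyPathConnectedSpace X] {i j y : X}
    (hy : y ∈ framedNhd X x₀ i ∩ framedNhd X x₀ j) :
    ∀ᶠ z in 𝓝 y, framingChange x₀ i j z = framingChange x₀ i j y := by
  obtain ⟨V, ⟨hV, hVp⟩, hVU⟩ := (path_connected_basis y).mem_iff.1
    (((isOpen_framedNhd X x₀ i).inter (isOpen_framedNhd X x₀ j)).mem_nhds hy)
  filter_upwards [hV] with z hz
  have hj := hVp.joinedIn y (mem_of_mem_nhds hV) z hz
  exact (framingChange_eq_of_path X x₀ hj.somePath fun t => hVU (hj.somePath_mem t)).symm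

variable [LocallyPathConnectedSpace X] (F : Type u) [TopologicalSpace F] [DiscreteTopology F]
  [MulAction (FundamentalGroup X x₀) F]

/-- The cocycle of the covering space with fibre `F` associated with an action of the fundamental
group on the discrete space `F`. The charts are indexed by their centres, and the fibre over `y` is
identified with `F` by the framing of the chart centred at `y`. -/
def associatedCore : FiberBundleCore X X F where
  baseSet := framedNhd X x₀
  isOpen_baseSet := isOpen_framedNhd X x₀
  indexAt := id
  mem_baseSet_at := mem_framedNhd X x₀
  coordChange i j y a := framingChange x₀ i j y • a
  coordChange_self i y _ a := by rw [framingChange_self, one_smul]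
  continuousOn_coordChange i j := by
    rintro ⟨y, a⟩ ⟨hy, -⟩
    refine ContinuousAt.continuousWithinAt (continuousAt_const.congr
      (f := fun _ => framingChange x₀ i j y • a) ?_)
    filter_upwards [prod_mem_nhds (framingChange_eventuallyEq X x₀ hy)
      (mem_nhds_discrete.2 rfl : {b | b = a} ∈ 𝓝 a)] with z hz
    have hz1 : framingChange x₀ i j z.1 = framingChange x₀ i j y := hz.1
    have hz2 : z.2 = a := hz.2
    rw [hz1, hz2]
  coordChange_comp i j k y _ a := by rw [smul_smul, framingChange_mul]

variable {X F}

/-- The point of the associated covering space reached from the element `a` of the fibre over `x₀`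
along the homotopy class `q`. In the framing at `y` its coordinate is the image of `a` under the
loop that follows `q` and returns along the framing. -/
def associatedPoint {y : X} (q : FundamentalGroupoid.mk x₀ ⟶ FundamentalGroupoid.mk y) (a : F) :
    (associatedCore X x₀ F).TotalSpace :=
  ⟨y, (show FundamentalGroup X x₀ from q ≫ inv (framing X x₀ y y)) • a⟩

/-- Going around a loop leads back to the starting point exactly if the loop fixes the element `a`
of the fibre. -/
theorem associatedPoint_eq_iff (q : FundamentalGroup X x₀) (a : F) :
    associatedPoint x₀ q a = associatedPoint x₀ (𝟙 (FundamentalGroupoid.mk x₀)) a ↔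
      q • a = a := by
  let f : FundamentalGroup X x₀ := inv (framing X x₀ x₀ x₀)
  have h (r : FundamentalGroup X x₀) : associatedPoint x₀ r a = ⟨x₀, f • r • a⟩ := by
    rw [smul_smul]
    rfl
  have h1 : associatedPoint x₀ (𝟙 (FundamentalGroupoid.mk x₀)) a =
      ⟨x₀, f • (1 : FundamentalGroup X x₀) • a⟩ := h 1
  rw [h, h1, one_smul]
  refine ⟨fun hq => smul_left_cancel f ?_, fun hq => by rw [hq]⟩
  exact eq_of_heq (Bundle.TotalSpace.mk.inj hq).2

theorem exists_associatedPoint_eq [MulAction.IsPretransitive (FundamentalGroup X x₀) F]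
    (a : F) (e : (associatedCore X x₀ F).TotalSpace) :
    ∃ q : FundamentalGroupoid.mk x₀ ⟶ FundamentalGroupoid.mk e.proj,
      associatedPoint x₀ q a = e := by
  obtain ⟨y, b⟩ := e
  obtain ⟨g, hg⟩ := MulAction.exists_smul_eq (FundamentalGroup X x₀) a (b : F)
  let g' : FundamentalGroupoid.mk x₀ ⟶ FundamentalGroupoid.mk x₀ := g
  refine ⟨g' ≫ framing X x₀ y y, ?_⟩
  simp only [associatedPoint, Category.assoc, IsIso.hom_inv_id, Category.comp_id]
  exact congrArg _ hg

/-- Transporting `a` along the initial segments of a path gives a continuous path: in the chart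
centred at a point of the path the coordinate is locally constant. -/
theorem continuous_associatedPoint {y : X} (γ : Path x₀ y) (a : F) :
    Continuous fun t : I =>
      associatedPoint x₀ ((γ.subpath 0 t).cast γ.source.symm rfl).toHom a := by
  refine continuous_iff_continuousAt.2 fun t => ?_
  rw [FiberBundle.continuousAt_totalSpace]
  refine ⟨γ.continuous.continuousAt, continuousAt_const.congr
    (f := fun _ => (show FundamentalGroup X x₀ from
      ((γ.subpath 0 t).cast γ.source.symm rfl).toHom ≫ inv (framing X x₀ (γ t) (γ t))) • a) ?_⟩
  -- By compactness of the interval, the whole subpath from `t` to `s` stays in the chart for `s`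
  -- near `t`.
  have hU : ∀ᶠ s in 𝓝 t, ∀ u ∈ (Set.univ : Set I), γ.subpath t s u ∈ framedNhd X x₀ (γ t) := by
    refine isCompact_univ.eventually_forall_of_forall_eventually fun u _ => ?_
    have hc : Continuous fun z : I × I => γ.subpath t z.1 z.2 :=
      γ.subpath_continuous_family.comp (by fun_prop : Continuous fun z : I × I => (t, z.1, z.2))
    refine hc.continuousAt.eventually_mem ((isOpen_framedNhd X x₀ (γ t)).mem_nhds ?_)
    simpa using mem_framedNhd X x₀ (γ t)
  filter_upwards [hU] with s hs
  have hfr := framing_comp X x₀ (γ t) (γ.subpath t s) fun u => hs u trivial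
  have hsub : ((γ.subpath 0 t).cast γ.source.symm rfl).toHom ≫ (γ.subpath t s).toHom =
      ((γ.subpath 0 s).cast γ.source.symm rfl).toHom := by
    rw [← Path.toHom_trans, Path.toHom_eq_iff]
    exact ⟨(Path.Homotopy.subpathTransSubpath γ 0 t s).pathCast γ.source.symm rfl⟩
  -- The coordinate in the chart centred at `γ t` of a point over `γ s`.
  have key (P : FundamentalGroupoid.mk x₀ ⟶ FundamentalGroupoid.mk (γ s)) :
      (trivializationAt F (associatedCore X x₀ F).Fiber (γ t) (associatedPoint x₀ P a)).2 =
      (show FundamentalGroup X x₀ from P ≫ inv (framing X x₀ (γ t) (γ s))) • a := by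
    have : (show FundamentalGroup X x₀ from P ≫ inv (framing X x₀ (γ t) (γ s))) =
        framingChange x₀ (γ s) (γ t) (γ s) *
          (show FundamentalGroup X x₀ from P ≫ inv (framing X x₀ (γ s) (γ s))) := by
      change _ = (P ≫ inv (framing X x₀ (γ s) (γ s))) ≫ framingChange x₀ (γ s) (γ t) (γ s)
      simp [framingChange]
    rw [this, mul_smul]
    rfl
  refine Eq.trans ?_ (key _).symm
  simp only [← hsub, ← hfr, IsIso.inv_comp, Category.assoc, IsIso.hom_inv_id_assoc]

/-- The lift of a path that starts at `x₀` to the associated covering space. -/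
def associatedLift {y : X} (γ : Path x₀ y) (a : F) :
    Path (associatedPoint x₀ (𝟙 (FundamentalGroupoid.mk x₀)) a)
      (associatedPoint x₀ γ.toHom a) where
  toFun t := associatedPoint x₀ ((γ.subpath 0 t).cast γ.source.symm rfl).toHom a
  continuous_toFun := continuous_associatedPoint x₀ γ a
  source' := by
    have h (z : X) (hz : z = x₀) (δ : Path x₀ z) (hδ : ∀ u, δ u = x₀) :
        associatedPoint x₀ δ.toHom a =
          associatedPoint x₀ (𝟙 (FundamentalGroupoid.mk x₀)) a := by
      subst hz
      rw [← Path.toHom_refl, show δ = Path.refl z from Path.ext (funext hδ)]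
    exact h _ γ.source _ fun u => by simp
  target' := by
    have h (z : X) (hz : z = y) (δ : Path x₀ z) (hδ : ∀ u, δ u = γ u) :
        associatedPoint x₀ δ.toHom a = associatedPoint x₀ γ.toHom a := by
      subst hz
      rw [show δ = γ from Path.ext (funext hδ)]
    exact h _ γ.target _ fun u => by simp

/-- The path-connected cover associated with a transitive action of the fundamental group. -/
def associatedCover [MulAction.IsPretransitive (FundamentalGroup X x₀) F] (a : F) :
    PathConnectedCover X x₀ where
  space := (associatedCore X x₀ F).TotalSpace
  pathConnected := by
    have hj (e) : Joined (associatedPoint x₀ (𝟙 (FundamentalGroupoid.mk x₀)) a) e := by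
      obtain ⟨q, hq⟩ := exists_associatedPoint_eq x₀ a e
      obtain ⟨γ, rfl⟩ := Path.toHom_surjective q
      exact ⟨(associatedLift x₀ γ a).cast rfl hq.symm⟩
    exact ⟨⟨associatedPoint x₀ (𝟙 (FundamentalGroupoid.mk x₀)) a⟩,
      fun e e' => (hj e).symm.trans (hj e')⟩
  base := associatedPoint x₀ (𝟙 (FundamentalGroupoid.mk x₀)) a
  proj := ⟨(associatedCore X x₀ F).proj, (associatedCore X x₀ F).continuous_proj⟩
  isCoveringMap := FiberBundle.isCoveringMap (F := F) (E := (associatedCore X x₀ F).Fiber)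
  proj_base := rfl

theorem subgroup_associatedCover [MulAction.IsPretransitive (FundamentalGroup X x₀) F] (a : F) :
    (associatedCover x₀ a).subgroup = MulAction.stabilizer (FundamentalGroup X x₀) a := by
  ext g
  rw [MulAction.mem_stabilizer_iff, ← associatedPoint_eq_iff]
  let C := associatedCover x₀ a
  constructor
  · rintro ⟨p, rfl⟩
    obtain ⟨δ, rfl⟩ := Path.toHom_surjective p
    let γ : Path x₀ x₀ := δ.map C.proj.continuous
    rw [show FundamentalGroup.mapOfEq (associatedCover x₀ a).proj (associatedCover x₀ a).proj_base
      δ.toHom = γ.toHom from FundamentalGroup.mapOfEq_apply ..]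
    -- By uniqueness of lifts, `δ` is the lift of its projection `γ`, so this lift closes up.
    have h : (δ : I → C.space) = associatedLift x₀ γ a :=
      C.isCoveringMap.eq_of_comp_eq δ.continuous (associatedLift x₀ γ a).continuous
        (funext fun t => rfl) 0 (δ.source.trans (associatedLift x₀ γ a).source.symm)
    have h1 := congrFun h 1
    rw [δ.target, (associatedLift x₀ γ a).target] at h1
    exact h1.symm
  · intro hg
    obtain ⟨γ, rfl⟩ := Path.toHom_surjective g
    let Γ : Path C.base C.base := (associatedLift x₀ γ a).cast rfl hg.symm
    exact ⟨Γ.toHom, FundamentalGroup.mapOfEq_apply ..⟩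

end Framing

/-! ### The Galois correspondence -/

section Classification

variable {X : Type u} [TopologicalSpace X] {x₀ : X}

/-- Every subgroup `H` comes from a cover: the one associated with the action on the cosets of `H`,
based at the coset of `1`, whose stabilizer is `H`. -/
theorem PathConnectedCover.exists_subgroup_eq [PathConnectedSpace X] [LocallyPathConnectedSpace X]
    [HasSimplyConnectedNhds X] (H : Subgroup (FundamentalGroup X x₀)) :
    ∃ C : PathConnectedCover X x₀, C.subgroup = H := by
  let _ : TopologicalSpace (FundamentalGroup X x₀ ⧸ H) := ⊥
  have : DiscreteTopology (FundamentalGroup X x₀ ⧸ H) := ⟨rfl⟩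
  exact ⟨associatedCover x₀ ((1 : FundamentalGroup X x₀) : FundamentalGroup X x₀ ⧸ H),
    (subgroup_associatedCover x₀ _).trans (MulAction.stabilizer_quotient H)⟩

theorem IsLocalHomeomorph.locallyPathConnectedSpace {E : Type*} [TopologicalSpace E]
    [LocallyPathConnectedSpace X] {f : E → X} (hf : IsLocalHomeomorph f) :
    LocallyPathConnectedSpace E :=
  -- The local homeomorphisms that `f` restricts to serve as charts of `E` with values in `X`.
  let _ : ChartedSpace X E :=
    { atlas := Set.univ
      chartAt := fun e => (hf e).choose
      mem_chart_source := fun e => (hf e).choose_spec.1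
      chart_mem_atlas := fun _ => trivial }
  ChartedSpace.locallyPathConnectedSpace X E

namespace PathConnectedCover

/-- The lifting criterion: covers are ordered as their subgroups. -/
theorem covers_iff [LocallyPathConnectedSpace X] {C D : PathConnectedCover X x₀} :
    C.Covers D ↔ C.subgroup ≤ D.subgroup := by
  refine ⟨Covers.subgroup_le, fun h => ?_⟩
  obtain ⟨E, e, p, hp, rfl⟩ := C
  have := hp.isLocalHomeomorph.locallyPathConnectedSpace
  obtain ⟨F, ⟨hF, hpF⟩, -⟩ := D.isCoveringMap.existsUnique_continuousMap_lifts_of_range_le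
    (f := p) (a₀ := e) D.proj_base (by
      rintro _ ⟨g, rfl⟩
      exact h ⟨g, (FundamentalGroup.mapOfEq_apply p rfl g).trans
        (Path.Homotopic.Quotient.cast_rfl_rfl _)⟩)
  exact ⟨F, hF, ContinuousMap.ext fun y => (congrFun hpF y).symm⟩

variable (X x₀) in
/-- The space itself, as a cover. -/
def trivial [PathConnectedSpace X] : PathConnectedCover X x₀ where
  space := X
  base := x₀
  proj := ContinuousMap.id X
  isCoveringMap := fun x =>
    have h : IsEvenlyCovered (ContinuousMap.id X) x Unit :=
      ⟨inferInstance, Set.univ, Set.mem_univ x, isOpen_univ, isOpen_univ,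
        (Homeomorph.prodPUnit _).symm, fun _ => rfl⟩
    h.to_isEvenlyCovered_preimage
  proj_base := rfl

theorem subgroup_trivial [PathConnectedSpace X] : (trivial X x₀).subgroup = ⊤ :=
  eq_top_iff.2 fun g _ => ⟨g, by
    obtain ⟨γ, rfl⟩ := Path.toHom_surjective g
    exact FundamentalGroup.mapOfEq_apply ..⟩

end PathConnectedCover

namespace CoverClass

variable [LocallyPathConnectedSpace X]

theorem le_iff_subgroup_le {c d : CoverClass X x₀} : c ≤ d ↔ d.subgroup ≤ c.subgroup :=
  Quotient.inductionOn₂ c d fun _ _ => PathConnectedCover.covers_iff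

variable [PathConnectedSpace X]

theorem isTrivial_iff {c : CoverClass X x₀} : c.IsTrivial ↔ c.subgroup = ⊤ := by
  constructor
  · rintro ⟨C, rfl, hC⟩
    have h : C.Isomorphic (PathConnectedCover.trivial X x₀) :=
      ⟨hC.homeomorph, C.proj_base, fun _ => rfl⟩
    exact top_le_iff.1 (PathConnectedCover.subgroup_trivial.ge.trans h.symm.covers.subgroup_le)
  · intro h
    refine ⟨PathConnectedCover.trivial X x₀, ?_, (Homeomorph.refl X).isHomeomorph⟩
    exact le_antisymm (α := CoverClass X x₀) (le_iff_subgroup_le.2 (le_top.trans_eq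
      PathConnectedCover.subgroup_trivial.symm)) (le_iff_subgroup_le.2 (le_top.trans_eq h.symm))

variable (X x₀) in
/-- The Galois correspondence: isomorphism classes of path-connected covers correspond to subgroups
of the fundamental group, with the order reversed. -/
def subgroupOrderIso [HasSimplyConnectedNhds X] :
    CoverClass X x₀ ≃o (Subgroup (FundamentalGroup X x₀))ᵒᵈ where
  toEquiv := Equiv.ofBijective (fun c => OrderDual.toDual c.subgroup)
    ⟨fun c d (h : c.subgroup = d.subgroup) =>
        le_antisymm (le_iff_subgroup_le.2 h.ge) (le_iff_subgroup_le.2 h.le),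
      fun H => by
        obtain ⟨C, hC⟩ := PathConnectedCover.exists_subgroup_eq (OrderDual.ofDual H)
        exact ⟨Quotient.mk _ C, hC⟩⟩
  map_rel_iff' := le_iff_subgroup_le.symm

variable [HasSimplyConnectedNhds X]

theorem subgroup_injective : Function.Injective (subgroup : CoverClass X x₀ → _) :=
  (subgroupOrderIso X x₀).injective

theorem exists_subgroup_eq (H : Subgroup (FundamentalGroup X x₀)) :
    ∃ c : CoverClass X x₀, c.subgroup = H :=
  (subgroupOrderIso X x₀).surjective (OrderDual.toDual H)

theorem isMinimal_iff {c : CoverClass X x₀} : c.IsMinimal ↔ IsCoatom c.subgroup := by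
  rw [IsMinimal, isTrivial_iff, IsCoatom]
  refine and_congr Iff.rfl ⟨fun h K hK => ?_, fun h d hd => isTrivial_iff.2 (h _ ?_)⟩
  · obtain ⟨d, rfl⟩ := exists_subgroup_eq K
    exact isTrivial_iff.1 (h d ((subgroupOrderIso X x₀).lt_iff_lt.1 hK))
  · exact (subgroupOrderIso X x₀).lt_iff_lt.2 hd

theorem isLUB_iff {S : Set (CoverClass X x₀)} {c : CoverClass X x₀} :
    IsLUB S c ↔ IsGLB (subgroup '' S) c.subgroup :=
  ((subgroupOrderIso X x₀).isLUB_image').symm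

theorem isJoinOfMinimal_iff {c : CoverClass X x₀} {m : ℕ} :
    c.IsJoinOfMinimal m ↔ ∃ S : Finset (Subgroup (FundamentalGroup X x₀)), S.card = m ∧
      (∀ M ∈ S, IsCoatom M) ∧ IsGLB (S : Set (Subgroup (FundamentalGroup X x₀))) c.subgroup := by
  constructor
  · rintro ⟨S, hS, hmin, hlub⟩
    refine ⟨S.map ⟨subgroup, subgroup_injective⟩, by simpa using hS, ?_, ?_⟩
    · simpa using fun s hs => isMinimal_iff.1 (hmin s hs)
    · simpa using isLUB_iff.1 hlub
  · rintro ⟨S, hS, hmin, hglb⟩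
    let e := (Equiv.ofBijective _ ⟨subgroup_injective (X := X) (x₀ := x₀), exists_subgroup_eq⟩).symm
    have he (H) : (e H).subgroup = H := e.symm_apply_apply H
    refine ⟨S.map e.toEmbedding, by simpa using hS, fun s hs => ?_, ?_⟩
    · obtain ⟨M, hM, rfl⟩ := Finset.mem_map.1 hs
      exact isMinimal_iff.2 ((he M).symm ▸ hmin M hM)
    · rw [isLUB_iff, Finset.coe_map, Set.image_image]
      simpa [he] using hglb

end CoverClass

end Classification
end

noncomputable section

open Module

/-! ### Counting subspaces -/

section Subspaces

variable (K V : Type*) [Field K] [Fintype K] [AddCommGroup V] [Module K V] [Finite V]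

/-- A linearly independent `k`-tuple is the same as a `k`-dimensional subspace together with a
linearly independent `k`-tuple of its vectors. -/
def linearIndependentEquivSigma (k : ℕ) :
    {s : Fin k → V // LinearIndependent K s} ≃
      Σ W : {W : Submodule K V // finrank K W = k}, {s : Fin k → W.1 // LinearIndependent K s} where
  toFun s := ⟨⟨Submodule.span K (Set.range s.1), by simpa using finrank_span_eq_card s.2⟩,
    ⟨fun i => ⟨s.1 i, Submodule.subset_span ⟨i, rfl⟩⟩,
      LinearIndependent.of_comp (Submodule.subtype _) s.2⟩⟩
  invFun x := ⟨fun i => x.2.1 i, x.2.2.map' (Submodule.subtype _) (Submodule.ker_subtype _)⟩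
  left_inv s := rfl
  right_inv := by
    rintro ⟨⟨W, hW⟩, ⟨s, hs⟩⟩
    change Fin k → W at s
    change LinearIndependent K s at hs
    have hspan : Submodule.span K (Set.range fun i => (s i : V)) = W := by
      refine Submodule.eq_of_le_of_finrank_eq ?_ ?_
      · rw [Submodule.span_le]
        rintro _ ⟨i, rfl⟩
        exact (s i).2
      · have := finrank_span_eq_card (hs.map' W.subtype W.ker_subtype)
        rw [Fintype.card_fin] at this
        exact this.trans hW.symm
    -- Comparing the tuples, which live in different types, needs the equality of subspaces first.
    have hext : ∀ (W' : Submodule K V), W' = W → ∀ (s' : Fin k → W') (hs' : LinearIndependent K s'),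
        (∀ i, (s' i : V) = s i) → HEq (Subtype.mk (p := fun s => LinearIndependent K s) s' hs')
          (Subtype.mk (p := fun s => LinearIndependent K s) s hs) := by
      rintro _ rfl s' hs' h
      have : s' = s := funext fun i => Subtype.ext (h i)
      subst this
      rfl
    exact Sigma.ext (Subtype.ext hspan) (hext _ hspan _ _ fun i => rfl)

/-- The number of `k`-dimensional subspaces, obtained by counting linearly independent `k`-tuples
according to their span. -/
theorem card_submodule_finrank_eq (k : ℕ) (hk : k ≤ finrank K V) :
    (Nat.card {W : Submodule K V // finrank K W = k} : ℚ) =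
      gaussianBinomial (finrank K V) k (Fintype.card K) := by
  have hq : 1 < Fintype.card K := Fintype.one_lt_card
  have hprod (n : ℕ) (hkn : k ≤ n) :
      ((∏ i : Fin k, (Fintype.card K ^ n - Fintype.card K ^ i.val) : ℕ) : ℚ) =
        ∏ i ∈ Finset.range k, ((Fintype.card K : ℚ) ^ n - (Fintype.card K : ℚ) ^ i) := by
    rw [← Fin.prod_univ_eq_prod_range
      (fun i => (Fintype.card K : ℚ) ^ n - (Fintype.card K : ℚ) ^ i), Nat.cast_prod]
    refine Finset.prod_congr rfl fun i _ => ?_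
    rw [Nat.cast_sub (Nat.pow_le_pow_right hq.le (i.2.le.trans hkn))]
    push_cast
    rfl
  let _ := Fintype.ofFinite {W : Submodule K V // finrank K W = k}
  have hcard := Nat.card_congr (linearIndependentEquivSigma K V k)
  rw [card_linearIndependent hk, Nat.card_sigma] at hcard
  have hfib (W : {W : Submodule K V // finrank K W = k}) :
      Nat.card {s : Fin k → W.1 // LinearIndependent K s} =
        ∏ i : Fin k, (Fintype.card K ^ k - Fintype.card K ^ i.val) := by
    rw [card_linearIndependent W.2.ge, W.2]
  simp only [hfib, Finset.sum_const, smul_eq_mul, Finset.card_univ, ← Nat.card_eq_fintype_card]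
    at hcard
  have hne : ∏ i ∈ Finset.range k, ((Fintype.card K : ℚ) ^ k - (Fintype.card K : ℚ) ^ i) ≠ 0 := by
    refine Finset.prod_ne_zero_iff.2 fun i hi => sub_ne_zero.2 (ne_of_gt ?_)
    exact pow_lt_pow_right₀ (by exact_mod_cast hq) (Finset.mem_range.1 hi)
  rw [gaussianBinomial, eq_div_iff hne, ← hprod _ hk, ← hprod _ le_rfl, ← Nat.card_eq_fintype_card]
  exact_mod_cast hcard.symm

theorem card_submodule_eq :
    (Nat.card (Submodule K V) : ℚ) = gaussianSum (finrank K V) (Fintype.card K) := by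
  let f (W : Submodule K V) : Fin (finrank K V + 1) :=
    ⟨finrank K W, Nat.lt_succ_of_le W.finrank_le⟩
  have hf (k : Fin (finrank K V + 1)) : Nat.card {W // f W = k} =
      Nat.card {W : Submodule K V // finrank K W = k} :=
    Nat.card_congr (Equiv.subtypeEquivRight fun W => Fin.ext_iff)
  rw [gaussianSum, ← Nat.card_congr (Equiv.sigmaFiberEquiv f), Nat.card_sigma,
    ← Fin.sum_univ_eq_sum_range (fun k => gaussianBinomial (finrank K V) k (Fintype.card K)),
    Nat.cast_sum]
  refine Finset.sum_congr rfl fun k _ => ?_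
  rw [hf, card_submodule_finrank_eq K V k (Nat.lt_succ_iff.1 k.2)]

end Subspaces

/-! ### Intersections of hyperplanes -/

section Coatoms

variable {K V : Type*} [Field K] [AddCommGroup V] [Module K V] [FiniteDimensional K V]

theorem finrank_add_one_of_isCoatom {M : Submodule K V} (hM : IsCoatom M) :
    finrank K M + 1 = finrank K V := by
  rw [← isSimpleModule_iff_isCoatom, isSimpleModule_iff_finrank_eq_one] at hM
  have := M.finrank_quotient_add_finrank
  omega

theorem finrank_le_finrank_inf_add_card (S : Finset (Submodule K V)) (hS : ∀ M ∈ S, IsCoatom M) :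
    finrank K V ≤ finrank K (S.inf id : Submodule K V) + S.card := by
  classical
  induction S using Finset.induction_on with
  | empty => rw [Finset.inf_empty, finrank_top]; exact Nat.le_add_right _ _
  | insert M S hMS ih =>
    have h1 := ih fun N hN => hS N (Finset.mem_insert_of_mem hN)
    have h2 := finrank_add_one_of_isCoatom (hS M (Finset.mem_insert_self _ _))
    have h3 := Submodule.finrank_sup_add_finrank_inf_eq M (S.inf id)
    have h4 := Submodule.finrank_le (M ⊔ S.inf id)
    rw [Finset.inf_insert, Finset.card_insert_of_notMem hMS, id]
    omega

/-- The hyperplanes are the kernels of the coordinate functions of a basis of `V ⧸ W`. -/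
theorem exists_finset_isCoatom_inf_eq (W : Submodule K V) :
    ∃ S : Finset (Submodule K V), S.card = finrank K V - finrank K W ∧
      (∀ M ∈ S, IsCoatom M) ∧ S.inf id = W := by
  classical
  let b := finBasis K (V ⧸ W)
  let φ (i) : V →ₗ[K] K := b.coord i ∘ₗ W.mkQ
  have hφ (i j) : ∃ v, φ i v = 1 ∧ (j ≠ i → φ j v = 0) := by
    obtain ⟨v, hv⟩ := W.mkQ_surjective (b i)
    exact ⟨v, by simp [φ, hv], fun hj => by simp [φ, hv, hj.symm]⟩
  -- `v ∈ ker (φ j) \ ker (φ i)` shows that different coordinates have different kernels.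
  refine ⟨Finset.univ.map ⟨fun i => LinearMap.ker (φ i), fun i j hij => ?_⟩, ?_, ?_, ?_⟩
  · by_contra hne
    obtain ⟨v, hv, hv'⟩ := hφ i j
    have hmem : v ∈ LinearMap.ker (φ i) := by
      change LinearMap.ker (φ i) = LinearMap.ker (φ j) at hij
      rw [hij]
      exact hv' (Ne.symm hne)
    rw [LinearMap.mem_ker, hv] at hmem
    exact one_ne_zero hmem
  · have := W.finrank_quotient_add_finrank
    rw [Finset.card_map, Finset.card_univ, Fintype.card_fin]
    omega
  · intro M hM
    obtain ⟨i, -, rfl⟩ := Finset.mem_map.1 hM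
    obtain ⟨v, hv, -⟩ := hφ i i
    exact LinearMap.isCoatom_ker_of_surjective fun c => ⟨c • v, by simp [hv]⟩
  · ext v
    rw [Finset.inf_map]
    simp only [Submodule.mem_finsetInf, Finset.mem_univ, true_imp_iff]
    rw [← Submodule.Quotient.mk_eq_zero W, ← b.forall_coord_eq_zero_iff]
    rfl

/-- The smallest number of hyperplanes with intersection `W` is the codimension of `W`. -/
theorem isLeast_card_isCoatom (W : Submodule K V) :
    IsLeast {m | ∃ S : Finset (Submodule K V), S.card = m ∧ (∀ M ∈ S, IsCoatom M) ∧
      IsGLB (S : Set (Submodule K V)) W} (finrank K V - finrank K W) := by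
  constructor
  · obtain ⟨S, hS, hc, rfl⟩ := exists_finset_isCoatom_inf_eq W
    exact ⟨S, hS, hc, S.isGLB_inf_id⟩
  · rintro _ ⟨S, rfl, hc, hW⟩
    have h := finrank_le_finrank_inf_add_card S hc
    rw [S.isGLB_inf_id.unique hW] at h
    omega

end Coatoms

/-! ### The Frattini quotient of a finite `p`-group -/

section ElementaryAbelian

variable {p : ℕ}

/-- The rank of an elementary abelian `p`-group is its dimension over `ZMod p`. -/
theorem rank_multiplicative_eq_finrank [Fact p.Prime] (V : Type*) [AddCommGroup V]
    [Module (ZMod p) V] [Finite V] :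
    Group.rank (Multiplicative V) = finrank (ZMod p) V := by
  classical
  apply le_antisymm
  · let b := finBasis (ZMod p) V
    let S : Finset (Multiplicative V) := Finset.univ.image fun i => Multiplicative.ofAdd (b i)
    have hS : Subgroup.closure (S : Set (Multiplicative V)) = ⊤ := by
      let W := AddSubgroup.toZModSubmodule p (AddSubgroup.toSubgroup.symm
        (Subgroup.closure (S : Set (Multiplicative V))))
      have hW : W = ⊤ := by
        rw [eq_top_iff, ← b.span_eq, Submodule.span_le]
        rintro _ ⟨i, rfl⟩
        have h : Multiplicative.ofAdd (b i) ∈ Subgroup.closure (S : Set (Multiplicative V)) :=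
          Subgroup.subset_closure (Finset.mem_coe.2 (Finset.mem_image_of_mem _ (Finset.mem_univ i)))
        exact h
      exact eq_top_iff.2 fun v _ => (hW.ge : ⊤ ≤ W) (Submodule.mem_top (x := v.toAdd))
    refine (Group.rank_le hS).trans (Finset.card_image_le.trans ?_)
    simp
  · obtain ⟨S, hS, htop⟩ := Group.rank_spec (Multiplicative V)
    let T : Finset V := S.image Multiplicative.toAdd
    have hT : Submodule.span (ZMod p) (T : Set V) = ⊤ := by
      let H := AddSubgroup.toSubgroup (Submodule.span (ZMod p) (T : Set V)).toAddSubgroup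
      have hH : H = ⊤ := by
        rw [eq_top_iff, ← htop, Subgroup.closure_le]
        intro v hv
        have h : v.toAdd ∈ Submodule.span (ZMod p) (T : Set V) :=
          Submodule.subset_span (Finset.mem_coe.2 (Finset.mem_image_of_mem _ hv))
        exact h
      exact eq_top_iff.2 fun v _ => (hH.ge : ⊤ ≤ H) (Subgroup.mem_top (Multiplicative.ofAdd v))
    rw [← hS, ← finrank_top (ZMod p) V, ← hT]
    exact (finrank_span_finset_le_card T).trans Finset.card_image_le

variable {G : Type*} [Group G] [Finite G]

/-- A maximal subgroup `M` of a finite `p`-group contains all `p`-th powers and all commutators: it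
is normal because the group is nilpotent, and the quotient by `M`, having no proper nontrivial
subgroup, is generated by an element of order `p`. -/
theorem IsPGroup.pow_mem_and_commutator_mem_of_isCoatom [Fact p.Prime] (hG : IsPGroup p G)
    {M : Subgroup G} (hM : IsCoatom M) :
    (∀ g, g ^ p ∈ M) ∧ ∀ g h, (g * h)⁻¹ * (h * g) ∈ M := by
  have hnil : Group.IsNilpotent G := hG.isNilpotent
  have hn : M.Normal := ((Group.isNilpotent_of_finite_tfae (G := G)).out 0 2 rfl rfl).1 hnil M hM
  have : Nontrivial (G ⧸ M) := QuotientGroup.nontrivial_iff.2 hM.1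
  obtain ⟨z, hz⟩ := exists_prime_orderOf_dvd_card' p
    ((hG.to_quotient M).card_eq_or_dvd.resolve_left Finite.one_lt_card.ne')
  have hlt : M < (Subgroup.zpowers z).comap (QuotientGroup.mk' M) := by
    refine lt_of_le_of_ne (fun g hg => ?_) fun h => ?_
    · rw [Subgroup.mem_comap, QuotientGroup.mk'_apply, (QuotientGroup.eq_one_iff g).2 hg]
      exact one_mem _
    · obtain ⟨g, rfl⟩ := QuotientGroup.mk'_surjective M z
      have hg : g ∈ M := by
        rw [h]
        exact Subgroup.mem_zpowers _
      rw [QuotientGroup.mk'_apply, (QuotientGroup.eq_one_iff g).2 hg, orderOf_one] at hz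
      exact (Fact.out : p.Prime).one_lt.ne hz
  have htop := hM.2 _ hlt
  have hzp (g : G) : ∃ k : ℤ, z ^ k = (g : G ⧸ M) := by
    have : g ∈ (Subgroup.zpowers z).comap (QuotientGroup.mk' M) := htop ▸ Subgroup.mem_top g
    exact this
  refine ⟨fun g => ?_, fun g h => ?_⟩
  · obtain ⟨k, hk⟩ := hzp g
    rw [← QuotientGroup.eq_one_iff, QuotientGroup.mk_pow, ← hk, ← zpow_natCast, ← zpow_mul,
      mul_comm, zpow_mul, zpow_natCast, ← hz, pow_orderOf_eq_one, one_zpow]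
  · obtain ⟨k, hk⟩ := hzp g
    obtain ⟨l, hl⟩ := hzp h
    rw [← QuotientGroup.eq, QuotientGroup.mk_mul, QuotientGroup.mk_mul, ← hk, ← hl, ← zpow_add,
      ← zpow_add, add_comm]

/-- The Frattini quotient of a finite `p`-group is elementary abelian: the Frattini subgroup is the
kernel of a homomorphism onto a vector space over `ZMod p`. -/
theorem IsPGroup.exists_ker_eq_frattini {G : Type u} [Group G] [Finite G] [Fact p.Prime]
    (hG : IsPGroup p G) :
    ∃ (V : Type u) (_ : AddCommGroup V) (_ : Module (ZMod p) V) (f : G →* Multiplicative V),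
      Function.Surjective f ∧ f.ker = frattini G := by
  have hmem (g : G) : g ∈ frattini G ↔ ∀ M : Subgroup G, IsCoatom M → g ∈ M := by
    simp [frattini, Order.radical, Subgroup.mem_iInf]
  let _ : CommGroup (G ⧸ frattini G) :=
    { (inferInstance : Group (G ⧸ frattini G)) with
      mul_comm := by
        rintro ⟨g⟩ ⟨h⟩
        exact QuotientGroup.eq.2 ((hmem _).2 fun M hM =>
          (hG.pow_mem_and_commutator_mem_of_isCoatom hM).2 g h) }
  let _ : Module (ZMod p) (Additive (G ⧸ frattini G)) := AddCommGroup.zmodModule (by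
    rintro ⟨g⟩
    exact (QuotientGroup.eq_one_iff (g ^ p)).2
      ((hmem _).2 fun M hM => (hG.pow_mem_and_commutator_mem_of_isCoatom hM).1 g))
  exact ⟨Additive (G ⧸ frattini G), inferInstance, inferInstance, QuotientGroup.mk' (frattini G),
    QuotientGroup.mk'_surjective _, QuotientGroup.ker_mk' _⟩

/-- Passing to the Frattini quotient does not change the rank, since the elements of the Frattini
subgroup can be omitted from any generating set. -/
theorem rank_eq_of_ker_eq_frattini {Q : Type*} [Group Q] [Finite Q] (f : G →* Q)
    (hf : Function.Surjective f) (hker : f.ker = frattini G) : Group.rank G = Group.rank Q := by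
  classical
  refine le_antisymm ?_ (Group.rank_le_of_surjective f hf)
  obtain ⟨T, hT, htop⟩ := Group.rank_spec Q
  let S := T.image (Function.surjInv hf)
  have hS : Subgroup.closure (S : Set G) = ⊤ := by
    refine frattini_nongenerating ?_
    rw [← hker, ← Subgroup.comap_map_eq, MonoidHom.map_closure]
    have : f '' S = T := by
      rw [Finset.coe_image, Set.image_image]
      simp [Function.surjInv_eq]
    rw [this, htop, Subgroup.comap_top]
  exact (Group.rank_le hS).trans (Finset.card_image_le.trans hT.le)

omit [Finite G]

variable {V : Type*} [AddCommGroup V] [Module (ZMod p) V]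

/-- The inverse image under `f` of a subspace, as a subgroup. -/
def submoduleComap (f : G →* Multiplicative V) (W : Submodule (ZMod p) V) : Subgroup G :=
  (AddSubgroup.toSubgroup W.toAddSubgroup).comap f

theorem mem_submoduleComap {f : G →* Multiplicative V} {W : Submodule (ZMod p) V} {g : G} :
    g ∈ submoduleComap f W ↔ (f g).toAdd ∈ W := Iff.rfl

variable (p) in
/-- For surjective `f`, taking inverse images is an embedding of the lattice of subspaces into the
lattice of subgroups. -/
def submoduleComapEmbedding (f : G →* Multiplicative V) (hf : Function.Surjective f) :
    Submodule (ZMod p) V ↪o Subgroup G :=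
  OrderEmbedding.ofMapLEIff (submoduleComap f)
    fun _ _ => Subgroup.comap_le_comap_of_surjective hf

variable (p) in
theorem exists_submoduleComap_eq (f : G →* Multiplicative V) {H : Subgroup G} (hH : f.ker ≤ H) :
    ∃ W : Submodule (ZMod p) V, submoduleComap f W = H :=
  ⟨AddSubgroup.toZModSubmodule p (AddSubgroup.toSubgroup.symm (H.map f)),
    Subgroup.comap_map_eq_self hH⟩

/-- The homomorphism `f`, restricted to the inverse image of a subspace. -/
def submoduleComapHom (f : G →* Multiplicative V) (W : Submodule (ZMod p) V) :
    submoduleComap f W →* Multiplicative W where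
  toFun g := Multiplicative.ofAdd ⟨(f g).toAdd, g.2⟩
  map_one' := by simp only [OneMemClass.coe_one, map_one]; rfl
  map_mul' g h := by simp only [Subgroup.coe_mul, map_mul]; rfl

theorem rank_quotient_eq_finrank [Fact p.Prime] [Finite G] [Finite V] (f : G →* Multiplicative V)
    (hf : Function.Surjective f) (W : Submodule (ZMod p) V) {N H : Subgroup G} [N.Normal]
    (hN : f.ker = N) (hH : H = submoduleComap f W) :
    Group.rank (H ⧸ N.subgroupOf H) = finrank (ZMod p) W := by
  subst hN hH
  have hs : Function.Surjective (submoduleComapHom f W) := by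
    rintro ⟨w, hw⟩
    obtain ⟨g, hg⟩ := hf (Multiplicative.ofAdd w)
    refine ⟨⟨g, ?_⟩, ?_⟩
    · rw [mem_submoduleComap, hg]
      exact hw
    · exact congrArg Multiplicative.ofAdd (Subtype.ext (congrArg Multiplicative.toAdd hg))
  have hk : (submoduleComapHom f W).ker = f.ker.subgroupOf (submoduleComap f W) := by
    ext g
    rw [MonoidHom.mem_ker, Subgroup.mem_subgroupOf, MonoidHom.mem_ker]
    exact Subtype.ext_iff
  rw [← rank_multiplicative_eq_finrank, ← Group.rank_congr
    ((QuotientGroup.quotientMulEquivOfEq hk.symm).trans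
      (QuotientGroup.quotientKerEquivOfSurjective _ hs))]

theorem gc_submoduleComap (f : G →* Multiplicative V) :
    GaloisConnection
      (fun H : Subgroup G => AddSubgroup.toZModSubmodule p (AddSubgroup.toSubgroup.symm (H.map f)))
      (submoduleComap f) :=
  fun H W => Subgroup.map_le_iff_le_comap (K := H) (H := AddSubgroup.toSubgroup W.toAddSubgroup)

theorem isCoatom_submoduleComap_iff {f : G →* Multiplicative V} (hf : Function.Surjective f)
    {W : Submodule (ZMod p) V} : IsCoatom (submoduleComap f W) ↔ IsCoatom W := by
  let ι := submoduleComapEmbedding p f hf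
  have htop (W : Submodule (ZMod p) V) : submoduleComap f W = ⊤ ↔ W = ⊤ :=
    ι.eq_iff_eq (b := ⊤)
  refine and_congr (not_congr (htop W)) ⟨fun h W' hW' => ?_, fun h K hK => ?_⟩
  · exact (htop W').1 (h _ (ι.lt_iff_lt.2 hW'))
  · obtain ⟨W', rfl⟩ := exists_submoduleComap_eq p f ((Subgroup.ker_le_comap f _).trans hK.le)
    exact (htop W').2 (h _ (ι.lt_iff_lt.1 hK))

/-- Since all maximal subgroups contain the Frattini subgroup, a subgroup that contains it is an
intersection of `m` maximal subgroups exactly if the corresponding subspace is an intersection of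
`m` hyperplanes. -/
theorem exists_finset_isCoatom_subgroup_iff {f : G →* Multiplicative V}
    (hf : Function.Surjective f) (hker : f.ker = frattini G) (W : Submodule (ZMod p) V) (m : ℕ) :
    (∃ S : Finset (Subgroup G), S.card = m ∧ (∀ M ∈ S, IsCoatom M) ∧
      IsGLB (S : Set (Subgroup G)) (submoduleComap f W)) ↔
    ∃ S : Finset (Submodule (ZMod p) V), S.card = m ∧ (∀ M ∈ S, IsCoatom M) ∧
      IsGLB (S : Set (Submodule (ZMod p) V)) W := by
  classical
  let ι := submoduleComapEmbedding p f hf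
  constructor
  · rintro ⟨S, hS, hc, hW⟩
    obtain ⟨T, -, rfl⟩ := Finset.subset_set_image_iff.1
      (show (S : Set (Subgroup G)) ⊆ ι '' Set.univ from fun M hM => by
        rw [Set.image_univ]
        exact exists_submoduleComap_eq p f (hker.trans_le (frattini_le_coatom (hc M hM))))
    refine ⟨T, ?_, fun M hM => ?_, ?_⟩
    · rwa [Finset.card_image_of_injective _ ι.injective] at hS
    · exact (isCoatom_submoduleComap_iff hf).1 (hc _ (Finset.mem_image_of_mem _ hM))
    · rw [Finset.coe_image] at hW
      exact hW.of_image ι.le_iff_le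
  · rintro ⟨S, hS, hc, hW⟩
    refine ⟨S.map ι.toEmbedding, by simpa using hS, fun M hM => ?_, ?_⟩
    · obtain ⟨N, hN, rfl⟩ := Finset.mem_map.1 hM
      exact (isCoatom_submoduleComap_iff hf).2 (hc N hN)
    · rw [Finset.coe_map]
      exact (gc_submoduleComap f).isGLB_u_image hW

end ElementaryAbelian
end

/-! ### Covers below the Frattini cover -/

namespace CoverClass

variable {X : Type u} [TopologicalSpace X] {x₀ : X} [PathConnectedSpace X]
  [LocallyPathConnectedSpace X] [HasSimplyConnectedNhds X]

/-- If `f` maps the fundamental group onto a vector space and `F` is the cover with subgroup `ker f`,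
then the classes covered by `F` correspond to the subspaces. -/
theorem exists_equiv_submodule {p : ℕ} {V : Type*} [AddCommGroup V] [Module (ZMod p) V]
    (f : FundamentalGroup X x₀ →* Multiplicative V) (hf : Function.Surjective f)
    {F : CoverClass X x₀} (hF : F.subgroup = f.ker) :
    ∃ σ : Submodule (ZMod p) V ≃ {c : CoverClass X x₀ // c ≤ F},
      ∀ W, (σ W).1.subgroup = submoduleComap f W := by
  choose g hg using fun W : Submodule (ZMod p) V => exists_subgroup_eq (submoduleComap f W)
  refine ⟨Equiv.ofBijective (fun W => ⟨g W, le_iff_subgroup_le.2 ?_⟩) ⟨fun W W' h => ?_, ?_⟩, hg⟩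
  · rw [hF, hg]
    exact Subgroup.ker_le_comap f _
  · have h' : g W = g W' := congrArg Subtype.val h
    apply (submoduleComapEmbedding p f hf).injective
    change submoduleComap f W = submoduleComap f W'
    rw [← hg, h', hg]
  · rintro ⟨c, hc⟩
    have hk : f.ker ≤ c.subgroup := hF.symm.trans_le (le_iff_subgroup_le.1 hc)
    obtain ⟨W, hW⟩ := exists_submoduleComap_eq p f hk
    exact ⟨W, Subtype.ext (subgroup_injective ((hg W).trans hW))⟩

theorem existsUnique_isFrattini : ∃! F : CoverClass X x₀, F.IsFrattini := by
  obtain ⟨F, hF⟩ := exists_subgroup_eq (frattini (FundamentalGroup X x₀))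
  exact ⟨F, hF, fun F' hF' => subgroup_injective (hF'.trans hF.symm)⟩

end CoverClass

theorem theorem5p1 {d : ℕ} (X : Type u) [TopologicalSpace X] [T2Space X] [CompactSpace X]
    [ConnectedSpace X] [ChartedSpace (EuclideanSpace ℝ (Fin d)) X] [IsManifold (𝓡 d) ∞ X]
    (x₀ : X) (p n : ℕ) (hp : p.Prime) [Finite (FundamentalGroup X x₀)]
    (hpgroup : IsPGroup p (FundamentalGroup X x₀))
    (hrank : Group.rank (FundamentalGroup X x₀) = n) :
    (∃! F : CoverClass X x₀, F.IsFrattini) ∧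
    ∀ F : CoverClass X x₀, F.IsFrattini →
      (Nat.card {c : CoverClass X x₀ // c ≤ F} : ℚ) = gaussianSum n p ∧
      (∀ k ≤ n, (Nat.card {c : CoverClass X x₀ // c ≤ F ∧ c.HasJoinNumber (n - k)} : ℚ) =
        gaussianBinomial n k p) ∧
      (∀ k ≤ n, (Nat.card {c : CoverClass X x₀ // c ≤ F ∧
          Group.rank (c.subgroup ⧸ (frattini (FundamentalGroup X x₀)).subgroupOf c.subgroup) = k} :
            ℚ) = gaussianBinomial n k p) := by
  have := Fact.mk hp
  have := ChartedSpace.locallyPathConnectedSpace (EuclideanSpace ℝ (Fin d)) X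
  have := HasSimplyConnectedNhds.of_chartedSpace (E := EuclideanSpace ℝ (Fin d)) X
  have : PathConnectedSpace X := PathConnectedSpace.of_locallyPathConnectedSpace
  refine ⟨CoverClass.existsUnique_isFrattini, fun F hF => ?_⟩
  -- `V` is the Frattini quotient of the fundamental group.
  obtain ⟨V, _, _, f, hf, hker⟩ := hpgroup.exists_ker_eq_frattini
  have : Finite V := Finite.of_surjective f hf
  have hn : Module.finrank (ZMod p) V = n := by
    rw [← rank_multiplicative_eq_finrank, ← rank_eq_of_ker_eq_frattini f hf hker, hrank]
  obtain ⟨σ, hσ⟩ := CoverClass.exists_equiv_submodule (p := p) f hf (hF.trans hker.symm)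
  have hcount (P : CoverClass X x₀ → Prop) (k : ℕ) (hk : k ≤ n)
      (hP : ∀ W, P (σ W).1 ↔ Module.finrank (ZMod p) W = k) :
      (Nat.card {c : CoverClass X x₀ // c ≤ F ∧ P c} : ℚ) = gaussianBinomial n k p := by
    rw [← Nat.card_congr (Equiv.subtypeSubtypeEquivSubtypeInter (· ≤ F) P),
      ← Nat.card_congr (σ.subtypeEquiv fun W => (hP W).symm),
      card_submodule_finrank_eq (ZMod p) V k (hk.trans_eq hn.symm), hn, ZMod.card]
  refine ⟨?_, fun k hk => hcount _ k hk fun W => ?_, fun k hk => hcount _ k hk fun W => ?_⟩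
  · rw [← Nat.card_congr σ, card_submodule_eq (ZMod p) V, hn, ZMod.card]
  · have hW : (σ W).1.HasJoinNumber (n - Module.finrank (ZMod p) W) := by
      have h := isLeast_card_isCoatom W
      simp only [← exists_finset_isCoatom_subgroup_iff hf hker, hn, ← hσ,
        ← CoverClass.isJoinOfMinimal_iff] at h
      exact h
    have hle : Module.finrank (ZMod p) W ≤ n := hn ▸ W.finrank_le
    -- Since `dim W ≤ n` and `k ≤ n`, the truncated differences `n - dim W` and `n - k` agree only
    -- if `dim W = k`.
    constructor
    · intro h
      have := h.unique hW
      omega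
    · rintro rfl
      exact hW
  · rw [rank_quotient_eq_finrank f hf W hker (hσ W)]
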